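/- All graphs are finite, without loops or multiple edges. A graph is chordal if it has no induced cycle on four or more vertices. Let $cc(G)$ be the least number of cliques of $G$ that together contain all edges of $G$. Positive zero forcing: let $B\subseteq V(G)$ be the set of black vertices and let the other vertices be white. A vertex $u\in B$ may force a white vertex $w$ to become black if, for the vertex set $W$ of the connected component of $G-B$ that contains $w$, the vertex $w$ is the only neighbour of $u$ in $W$. The set $B$ is a positive zero forcing set if repeated application of this rule, starting with $B$ black, makes all vertices black; it is optimal if it has the smallest possible size, and this size is denoted by $Z_+(G)$. Algorithm Zplus-Chordal, on a connected chordal graph $G$ with $n$ vertices, all of whose vertices and edges are uncoloured: let $(v_1,\dots,v_n)$ be the reverse of an ordering in which a lexicographic breadth-first search visits $G$. For $i=1,\dots,n-1$ in turn, let $G_i=G-\{v_1,\dots,v_{i-1}\}$ and let $C_i$ be the set consisting of $v_i$ and its neighbours in $G_i$. If some edge of $G_i$ incident to $v_i$ is uncoloured, choose one such edge, colour it black, colour all other uncoloured edges inside $C_i$ red, and colour $v_i$ white; otherwise colour $v_i$ black. Finally colour $v_n$ black. On a disconnected chordal graph the algorithm is run on each connected component separately. Let $V_{\mathrm{black}}(G)$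 be the set of all black vertices and $V_{\mathrm{white}}(G)$ the set of all white vertices in the end. Theorem. Let $G$ be a chordal graph. The algorithm can be carried out, and the orderings $(v_1,\dots,v_n)$ that it uses are perfect elimination orderings, that is, each $v_i$ is simplicial in $G_i$ (so that each $C_i$ is a clique). For every possible choice of the orderings and of the black edges, $V_{\mathrm{black}}(G)$ is an optimal positive zero forcing set of $G$, $V_{\mathrm{white}}(G)=V(G)\setminus V_{\mathrm{black}}(G)$, and the number of black edges equals $|V_{\mathrm{white}}(G)|$. Moreover $$Z_+(G)=|V(G)|-cc(G)=|V_{\mathrm{black}}(G)|.$$ The same holds if arbitrary perfect elimination orderings of the connected components are used in place of those given by lexicographic breadth-first search. -/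

import Mathlib

namespace ZplusChordal

variable {V : Type*}

/-- A graph is chordal if it has no induced cycle on four or more vertices. -/
def IsChordal (G : SimpleGraph V) : Prop :=
  ∀ n : ℕ, 4 ≤ n → ¬ (SimpleGraph.cycleGraph n).IsIndContained G

/-! ### Positive zero forcing -/

/-- The positive colour change rule: with black set `B`, the black vertex `u` can force the white
vertex `w` if `w` is the only neighbour of `u` in the component of `G - B` that contains `w`. -/
def CanForce (G : SimpleGraph V) (B : Set V) (u w : V) : Prop :=
  u ∈ B ∧ G.Adj u w ∧ ∃ hw : w ∈ Bᶜ, ∀ (x : V) (hx : x ∈ Bᶜ),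
    G.Adj u x → (G.induce Bᶜ).Reachable ⟨w, hw⟩ ⟨x, hx⟩ → x = w

/-- One application of the positive colour change rule turns the black set `B` into `B'`. -/
def ForceStep (G : SimpleGraph V) (B B' : Set V) : Prop :=
  ∃ u w : V, CanForce G B u w ∧ B' = insert w B

/-- `B` is a positive zero forcing set if repeated application of the positive colour change rule,
starting with `B` black, colours all vertices black. -/
def IsPositiveZeroForcingSet (G : SimpleGraph V) (B : Set V) : Prop :=
  Relation.ReflTransGen (ForceStep G) B Set.univ

/-- A positive zero forcing set of the smallest possible size (for finite `V`). -/
def IsOptimalPositiveZeroForcingSet (G : SimpleGraph V) (B : Set V) : Prop :=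
  IsPositiveZeroForcingSet G B ∧
    ∀ B' : Set V, IsPositiveZeroForcingSet G B' → B.ncard ≤ B'.ncard

/-- The positive zero forcing number `Z₊(G)`. -/
noncomputable def positiveZeroForcingNumber (G : SimpleGraph V) : ℕ :=
  sInf {k : ℕ | ∃ B : Set V, IsPositiveZeroForcingSet G B ∧ B.ncard = k}

/-! ### Clique covers -/

/-- A family of cliques that covers all edges of `G`. -/
def IsCliqueCover (G : SimpleGraph V) (K : Finset (Finset V)) : Prop :=
  (∀ C ∈ K, G.IsClique (C : Set V)) ∧ ∀ u v : V, G.Adj u v → ∃ C ∈ K, u ∈ C ∧ v ∈ C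

/-- The (edge) clique cover number `cc(G)`. -/
noncomputable def cliqueCoverNumber (G : SimpleGraph V) : ℕ :=
  sInf {k : ℕ | ∃ K : Finset (Finset V), IsCliqueCover G K ∧ K.card = k}

/-! ### Vertex orderings -/

/-- The list `l` enumerates the set `U` without repetition. -/
def IsOrderingOf (l : List V) (U : Set V) : Prop :=
  l.Nodup ∧ ∀ v : V, v ∈ l ↔ v ∈ U

/-- The elimination condition for the graph induced by the entries of a list: each entry is
simplicial in the graph induced by itself and the entries after it. -/
def IsPerfectElimination (G : SimpleGraph V) : List V → Prop
  | [] => True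
  | v :: rest => G.IsClique {w | w ∈ rest ∧ G.Adj v w} ∧ IsPerfectElimination G rest

open Classical in
/-- The label of `v` in a lexicographic breadth-first search, after the vertices in the list have
been visited in this order and have received the numbers `n, n - 1, …`: the decreasing list of the
numbers of the visited neighbours of `v`. -/
noncomputable def lexLabel (G : SimpleGraph V) : ℕ → List V → V → List ℕ
  | _, [], _ => []
  | n, x :: visited, v =>
      if G.Adj x v then n :: lexLabel G (n - 1) visited v else lexLabel G (n - 1) visited v

/-- The list `l` is the order in which some lexicographic breadth-first search (with ties broken
arbitrarily) visits the graph induced by the entries of `l`: the vertex visited next always has a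
lexicographically largest label among the vertices not yet visited. -/
def IsLexBFSOrder (G : SimpleGraph V) (l : List V) : Prop :=
  ∀ (visited : List V) (x : V) (unvisited : List V), l = visited ++ x :: unvisited →
    ∀ y ∈ unvisited, lexLabel G l.length visited y ≤ lexLabel G l.length visited x

/-! ### The algorithm -/

/-- A partial colouring of vertices (black, white) and edges (black, red). -/
structure Colouring (V : Type*) where
  blackVerts : Set V
  whiteVerts : Set V
  blackEdges : Set (Sym2 V)
  redEdges : Set (Sym2 V)

/-- Nothing is coloured. -/
def Colouring.empty : Colouring V := ⟨∅, ∅, ∅, ∅⟩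

def Colouring.colouredEdges (s : Colouring V) : Set (Sym2 V) := s.blackEdges ∪ s.redEdges

/-- Colour the vertex `v` black. -/
def Colouring.colourBlack (s : Colouring V) (v : V) : Colouring V :=
  { s with blackVerts := insert v s.blackVerts }

/-- Colour the vertex `v` white and the edge `e` black, and all other uncoloured edges in the set
`F` red. -/
def Colouring.colourWhite (s : Colouring V) (v : V) (e : Sym2 V) (F : Set (Sym2 V)) :
    Colouring V where
  blackVerts := s.blackVerts
  whiteVerts := insert v s.whiteVerts
  blackEdges := insert e s.blackEdges
  redEdges := s.redEdges ∪ {f | f ∈ F ∧ f ∉ s.colouredEdges ∧ f ≠ e}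

/-- The edges of the clique formed by `v` and its neighbours in `rest`. -/
def closedNeighbourhoodEdges (G : SimpleGraph V) (v : V) (rest : List V) : Set (Sym2 V) :=
  {f | f ∈ G.edgeSet ∧ ∀ x ∈ f, x = v ∨ (x ∈ rest ∧ G.Adj v x)}

/-- `Loop G l s t`: the elimination loop of the algorithm, when the vertices still present are the
entries of `l`, to be eliminated in this order, and the current colouring is `s`, can end with
the colouring `t`.
* `last`: the last remaining vertex is coloured black.
* `white`: the first vertex `v` has a remaining uncoloured edge `vw`; one such edge becomes black,
  all other uncoloured edges of the clique of `v` become red, and `v` becomes white.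
* `black`: all remaining edges at `v` are coloured; `v` becomes black. -/
inductive Loop (G : SimpleGraph V) : List V → Colouring V → Colouring V → Prop
  | last (v : V) (s : Colouring V) : Loop G [v] s (s.colourBlack v)
  | white (v w : V) (rest : List V) (s t : Colouring V) (hw : w ∈ rest) (hvw : G.Adj v w)
      (hun : s(v, w) ∉ s.colouredEdges)
      (hrun : Loop G rest
        (s.colourWhite v s(v, w) (closedNeighbourhoodEdges G v rest)) t) :
      Loop G (v :: rest) s t
  | black (v : V) (rest : List V) (s t : Colouring V) (hrest : rest ≠ [])
      (hcol : ∀ w ∈ rest, G.Adj v w → s(v, w) ∈ s.colouredEdges)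
      (hrun : Loop G rest (s.colourBlack v) t) :
      Loop G (v :: rest) s t

/-- `s` is a final colouring of `G` obtained by running the algorithm on every connected component
`C` of `G`, with the vertices of `C` eliminated in the order `σ C`. -/
def IsRunWith (G : SimpleGraph V) (σ : G.ConnectedComponent → List V) (s : Colouring V) : Prop :=
  ∃ t : G.ConnectedComponent → Colouring V,
    (∀ C, Loop G (σ C) Colouring.empty (t C)) ∧
    s.blackVerts = ⋃ C, (t C).blackVerts ∧
    s.whiteVerts = ⋃ C, (t C).whiteVerts ∧
    s.blackEdges = ⋃ C, (t C).blackEdges ∧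
    s.redEdges = ⋃ C, (t C).redEdges

/-- `s` is a final colouring of `G` that the algorithm Zplus-Chordal can produce: every component
is eliminated in the reverse of a lexicographic breadth-first search order. -/
def IsZplusChordalRun (G : SimpleGraph V) (s : Colouring V) : Prop :=
  ∃ σ : G.ConnectedComponent → List V,
    (∀ C, IsOrderingOf (σ C) C.supp ∧ IsLexBFSOrder G (σ C).reverse) ∧ IsRunWith G σ s

/-- `s` is a final colouring of `G` obtained in the same way, but with arbitrary perfect
elimination orderings of the components. -/
def IsPerfectEliminationRun (G : SimpleGraph V) (s : Colouring V) : Prop :=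
  ∃ σ : G.ConnectedComponent → List V,
    (∀ C, IsOrderingOf (σ C) C.supp ∧ IsPerfectElimination G (σ C)) ∧ IsRunWith G σ s

end ZplusChordal

/-! The equalities come from a sandwich. Lower bound, for every graph: fix a clique cover `K` and
give each forced vertex a clique of `K` containing the edge along which it is forced. No clique is
used twice: another white vertex of that clique would lie in the same white component and be a
second neighbour of the forcing vertex. Hence `|V| - |B| ≤ |K|` for every positive zero forcing set
`B` (`exists_injOn_cliqueCover`).

Upper bound: let a run along perfect elimination orderings leave the white set `W` with black edges
`s(v, f v)`. Every edge ends up coloured, and edges are coloured only inside cliques `C_p` with `p ∈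
W`, so these cliques form a cover. The black vertices force `W` in reverse order of elimination, `v`
being forced by `f v`. If `f v` had a second neighbour in the white component of `v`, simpliciality
would give a white common neighbour `p` of `v` and `f v` eliminated before `v`
(`exists_common_neighbour`), and the edge would already have been coloured at the turn of `p`. So
the black vertices force, the cover has at most `|W|` cliques, and the lower bound makes both
optimal.

Lexicographic search: if `v` had nonadjacent neighbours `a`, `b` visited before it, comparing labels
would produce earlier and earlier distinguishing vertices, until they connect `a` to `b` outside the
closed neighbourhood of `v` (`IsLexBFSOrder.adj_of_lt`). A shortest such connection closes up
through `v` to an induced cycle (`IsChordal.not_joinedIn_avoiding`). -/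

namespace ZplusChordal

variable {V : Type*}

/-! ### Connection inside a vertex set -/

/-- `x` is joined to `y` by a walk inside the set `S`. -/
def JoinedIn (G : SimpleGraph V) (S : Set V) : V → V → Prop :=
  Relation.ReflTransGen fun x y => G.Adj x y ∧ x ∈ S ∧ y ∈ S

theorem joinedIn_of_reachable {G : SimpleGraph V} {S : Set V} {x y : S}
    (h : (G.induce S).Reachable x y) : JoinedIn G S x y := by
  rw [SimpleGraph.reachable_iff_reflTransGen] at h
  exact h.lift Subtype.val fun a b hab => ⟨hab, a.2, b.2⟩

theorem JoinedIn.symm {G : SimpleGraph V} {S : Set V} {x y : V} (h : JoinedIn G S x y) :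
    JoinedIn G S y x := by
  have : Std.Symm fun x y => G.Adj x y ∧ x ∈ S ∧ y ∈ S := ⟨fun a b h => ⟨h.1.symm, h.2.2, h.2.1⟩⟩
  exact Std.Symm.symm (r := Relation.ReflTransGen fun x y => G.Adj x y ∧ x ∈ S ∧ y ∈ S) _ _ h

/-- Removing a vertex whose neighbours in `S` form a clique does not disconnect the rest of `S`. -/
theorem JoinedIn.diff_simplicial {G : SimpleGraph V} {S : Set V} {m : V}
    (hm : ∀ a ∈ S, ∀ b ∈ S, G.Adj m a → G.Adj m b → a ≠ b → G.Adj a b)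
    {x y : V} (h : JoinedIn G S x y) (hy : y ≠ m) (hx : x ≠ m) :
    JoinedIn G (S \ {m}) x y := by
  -- A visit to `m` is bypassed, since its predecessor and successor are equal or adjacent. The
  -- second clause carries the pending predecessor `a` through an induction from the front of the
  -- walk.
  suffices H : (x ≠ m → JoinedIn G (S \ {m}) x y) ∧
      (x = m → ∀ a ∈ S, G.Adj m a → JoinedIn G (S \ {m}) a y) from H.1 hx
  clear hx
  induction h using Relation.ReflTransGen.head_induction_on with
  | refl => exact ⟨fun _ => .refl, fun h => absurd h hy⟩
  | @head a c hac _ ih =>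
    obtain ⟨hadj, haS, hcS⟩ := hac
    refine ⟨fun ham => ?_, fun ham b hb hmb => ?_⟩
    · by_cases hcm : c = m
      · exact ih.2 hcm a haS (hcm ▸ hadj.symm)
      · exact .head ⟨hadj, ⟨haS, ham⟩, ⟨hcS, hcm⟩⟩ (ih.1 hcm)
    · subst ham
      have hcm : c ≠ a := hadj.ne'
      by_cases hbc : b = c
      · exact hbc ▸ ih.1 hcm
      · exact .head ⟨hm b hb c hcS hmb hadj hbc, ⟨hb, hmb.ne'⟩, ⟨hcS, hcm⟩⟩ (ih.1 hcm)

/-! ### Lower bound for positive zero forcing -/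

/-- The forces of a positive zero forcing process lie in distinct cliques of a clique cover. -/
theorem exists_injOn_cliqueCover {G : SimpleGraph V} {B : Set V} {K : Finset (Finset V)}
    (hB : IsPositiveZeroForcingSet G B) (hK : IsCliqueCover G K) :
    ∃ g : V → Finset V, (∀ w ∉ B, g w ∈ K ∧ w ∈ g w) ∧ Set.InjOn g Bᶜ := by
  classical
  induction hB using Relation.ReflTransGen.head_induction_on with
  | refl => exact ⟨fun _ => ∅, by simp, by simp⟩
  | @head B B' hstep _ ih =>
    obtain ⟨g, hg, hinj⟩ := ih
    obtain ⟨u, w, ⟨huB, huw, hw, huniq⟩, rfl⟩ := hstep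
    obtain ⟨C, hCK, huC, hwC⟩ := hK.2 u w huw
    -- A white `x ≠ w` with clique `C` would be adjacent to both `u` and `w`, hence a second
    -- neighbour of `u` in the component of `w`.
    have key : ∀ x ∉ B, x ≠ w → g x ≠ C := by
      intro x hx hxw hgx
      have hxC : x ∈ C := hgx ▸ (hg x (by simp [hx, hxw])).2
      have hux : G.Adj u x := hK.1 C hCK huC hxC (fun h => hx (h ▸ huB))
      have hwx : G.Adj w x := hK.1 C hCK hwC hxC hxw.symm
      exact hxw (huniq x hx hux (SimpleGraph.Adj.reachable (by simpa using hwx)))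
    refine ⟨Function.update g w C, fun x hx => ?_, fun x hx y hy hxy => ?_⟩
    · by_cases hxw : x = w
      · subst hxw; simp [hCK, hwC]
      · simpa [Function.update_of_ne hxw] using hg x (by simp [hx, hxw])
    · by_cases hxw : x = w <;> by_cases hyw : y = w
      · rw [hxw, hyw]
      · subst hxw
        rw [Function.update_self, Function.update_of_ne hyw] at hxy
        exact absurd hxy.symm (key y hy hyw)
      · subst hyw
        rw [Function.update_self, Function.update_of_ne hxw] at hxy
        exact absurd hxy (key x hx hxw)
      · rw [Function.update_of_ne hxw, Function.update_of_ne hyw] at hxy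
        exact hinj (by simpa [hxw] using hx) (by simpa [hyw] using hy) hxy

theorem card_le_ncard_add_card_cliqueCover [Fintype V] {G : SimpleGraph V} {B : Set V}
    {K : Finset (Finset V)} (hB : IsPositiveZeroForcingSet G B) (hK : IsCliqueCover G K) :
    Fintype.card V ≤ B.ncard + K.card := by
  obtain ⟨g, hg, hinj⟩ := exists_injOn_cliqueCover hB hK
  have h := Set.ncard_le_ncard_of_injOn (s := Bᶜ) (t := (K : Set (Finset V))) g
    (fun w hw => (hg w hw).1) hinj
  rw [Set.ncard_coe_finset] at h
  have := Set.ncard_add_ncard_compl B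
  rw [Nat.card_eq_fintype_card] at this
  omega

/-! ### Elimination by rank -/

section Rank

variable {α : Type*} [LinearOrder α]

/-- The white vertices `W` with their black edges `s(v, f v)`, as left behind by an elimination of
all vertices in the order of increasing `r`. -/
structure IsElimination (G : SimpleGraph V) (r : V → α) (W : Set V) (f : V → V) : Prop where
  injective : Function.Injective r
  simplicial : ∀ v a b, G.Adj v a → G.Adj v b → r v < r a → r v < r b → a ≠ b → G.Adj a b
  adj : ∀ v ∈ W, G.Adj v (f v)
  lt : ∀ v ∈ W, r v < r (f v)
  uncoloured : ∀ v ∈ W, ∀ p ∈ W, r p < r v → G.Adj p v → ¬ G.Adj p (f v)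
  covered : ∀ u v, G.Adj u v →
    ∃ p ∈ W, (u = p ∨ G.Adj p u ∧ r p < r u) ∧ (v = p ∨ G.Adj p v ∧ r p < r v)

/-- If the neighbour `w` of `v`, eliminated after all of `S`, has another neighbour in the
component of `v` in `S`, then `v` and `w` have a common neighbour in `S`. -/
theorem exists_common_neighbour [Finite V] {G : SimpleGraph V} {r : V → α}
    (hr : Function.Injective r)
    (hs : ∀ v a b, G.Adj v a → G.Adj v b → r v < r a → r v < r b → a ≠ b → G.Adj a b)
    {v w : V} (n : ℕ) : ∀ (S : Set V) (x : V), S.ncard = n → v ∈ S → x ∈ S → x ≠ v →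
      (∀ y ∈ S, r y < r w) → (∀ y ∈ S, r y ≤ r v) → G.Adj w x → JoinedIn G S v x →
      ∃ p ∈ S, p ≠ v ∧ G.Adj p v ∧ G.Adj p w := by
  induction n with
  | zero =>
    intro S x hn hv
    exact absurd ((Set.ncard_eq_zero (Set.toFinite S)).1 hn ▸ hv) (Set.notMem_empty v)
  | succ n ih =>
    intro S x hn hv hx hxv hSw hSv hwx hjoin
    obtain ⟨m, hmS, hmin⟩ := Set.exists_min_image S r (Set.toFinite S) ⟨v, hv⟩
    have hmlt : ∀ y ∈ S, y ≠ m → r m < r y := fun y hy hym =>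
      lt_of_le_of_ne (hmin y hy) fun h => hym (hr h).symm
    have hmv : v ≠ m := fun h => hxv (hr (le_antisymm (hSv x hx) (h ▸ hmin x hx)))
    have hsimp : ∀ a ∈ S, ∀ b ∈ S, G.Adj m a → G.Adj m b → a ≠ b → G.Adj a b :=
      fun a ha b hb hma hmb => hs m a b hma hmb (hmlt a ha hma.ne') (hmlt b hb hmb.ne')
    have step : ∀ y ∈ S, y ≠ m → y ≠ v → G.Adj w y → JoinedIn G S v y →
        ∃ p ∈ S, p ≠ v ∧ G.Adj p v ∧ G.Adj p w := by
      intro y hy hym hyv hwy hj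
      obtain ⟨p, hp, h⟩ := ih (S \ {m}) y (by rw [Set.ncard_sdiff_singleton_of_mem hmS, hn]; rfl)
        ⟨hv, hmv⟩ ⟨hy, hym⟩ hyv (fun z hz => hSw z hz.1) (fun z hz => hSv z hz.1) hwy
        (hj.diff_simplicial hsimp hym hmv)
      exact ⟨p, hp.1, h⟩
    -- The first vertex `m` of `S` can be deleted unless it is `x` itself. In that case, let `y`
    -- precede `x` on the walk: either `y = v` and `x` is the common neighbour, or `y` and `w` are
    -- later neighbours of `x`, hence adjacent, and `y` replaces `x`.
    by_cases hxm : x = m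
    · subst hxm
      rcases hjoin.cases_tail with h | ⟨y, hvy, hyx, hyS, -⟩
      · exact absurd h hxv
      · by_cases hyv : y = v
        · subst hyv
          exact ⟨x, hx, hxv, hyx.symm, hwx.symm⟩
        · have hyw : y ≠ w := fun h => (hSw y hyS).ne (h ▸ rfl)
          exact step y hyS hyx.ne hyv
            (hs x y w hyx.symm hwx.symm (hmlt y hyS hyx.ne) (hSw x hx) hyw).symm hvy
    · exact step x hx hxm hxv hwx hjoin

/-- Induction on the set `S` of vertices still white, forcing its last eliminated vertex `v`. Its
partner `f v` comes after all of `S`, so it is already black. -/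
theorem IsElimination.isPositiveZeroForcingSet [Finite V] {G : SimpleGraph V} {r : V → α}
    {W : Set V} {f : V → V} (h : IsElimination G r W f) : IsPositiveZeroForcingSet G Wᶜ := by
  suffices H : ∀ (n : ℕ) (S : Set V), S ⊆ W → S.ncard = n → IsPositiveZeroForcingSet G Sᶜ from
    H _ W subset_rfl rfl
  intro n
  induction n with
  | zero =>
    intro S _ hn
    rw [(Set.ncard_eq_zero (Set.toFinite S)).1 hn, Set.compl_empty]
    exact .refl
  | succ n ih =>
    intro S hSW hn
    have hne : S.Nonempty := Set.nonempty_of_ncard_ne_zero (by omega)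
    obtain ⟨v, hvS, hmax⟩ := Set.exists_max_image S r (Set.toFinite S) hne
    have hvW := hSW hvS
    have hlt : ∀ y ∈ S, r y < r (f v) := fun y hy => (hmax y hy).trans_lt (h.lt v hvW)
    refine .head (b := (S \ {v})ᶜ) ⟨f v, v, ⟨fun hf => (hlt _ hf).false, (h.adj v hvW).symm,
      by simpa using hvS, fun x hx hfx hreach => ?_⟩, ?_⟩
      (ih _ (Set.sdiff_subset.trans hSW) (by rw [Set.ncard_sdiff_singleton_of_mem hvS, hn]; rfl))
    · by_contra hxv
      have hj : JoinedIn G Sᶜᶜ v x := joinedIn_of_reachable hreach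
      rw [compl_compl] at hx hj
      obtain ⟨p, hpS, hpv, hadj, hadj'⟩ := exists_common_neighbour h.injective h.simplicial _ S x
        rfl hvS hx hxv hlt hmax hfx hj
      exact h.uncoloured v hvW p (hSW hpS)
        (lt_of_le_of_ne (hmax p hpS) fun e => hpv (h.injective e)) hadj hadj'
    · ext x
      simp only [Set.mem_compl_iff, Set.mem_sdiff, Set.mem_singleton_iff, Set.mem_insert_iff]
      tauto

/-- Each `p ∈ W` contributes the clique of `p` and its later neighbours. An inequality suffices,
because equality follows from the forcing bound. -/
theorem IsElimination.exists_cliqueCover [Finite V] {G : SimpleGraph V} {r : V → α}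
    {W : Set V} {f : V → V} (h : IsElimination G r W f) :
    ∃ K : Finset (Finset V), IsCliqueCover G K ∧ K.card ≤ W.ncard := by
  classical
  have := Fintype.ofFinite V
  let c : V → Finset V := fun p => {x | x = p ∨ G.Adj p x ∧ r p < r x}
  refine ⟨(Set.toFinite W).toFinset.image c, ⟨fun C hC => ?_, fun u v huv => ?_⟩, ?_⟩
  · obtain ⟨p, -, rfl⟩ := Finset.mem_image.1 hC
    intro a ha b hb hab
    simp only [c, Finset.coe_filter, Finset.mem_univ, true_and, Set.mem_ofPred_eq] at ha hb
    rcases ha with rfl | ha <;> rcases hb with rfl | hb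
    · exact absurd rfl hab
    · exact hb.1
    · exact ha.1.symm
    · exact h.simplicial p a b ha.1 hb.1 ha.2 hb.2 hab
  · obtain ⟨p, hp, hu, hv⟩ := h.covered u v huv
    exact ⟨c p, Finset.mem_image_of_mem c (by simpa using hp), by simpa [c] using hu,
      by simpa [c] using hv⟩
  · exact Finset.card_image_le.trans (Set.ncard_eq_toFinset_card W).ge

/-- The edge determines `v` as its endpoint of smaller rank. -/
theorem IsElimination.injOn_edge {G : SimpleGraph V} {r : V → α}
    {W : Set V} {f : V → V} (h : IsElimination G r W f) :
    Set.InjOn (fun v => s(v, f v)) W := by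
  intro v hv u hu huv
  rcases Sym2.eq_iff.1 huv with ⟨e, -⟩ | ⟨e, e'⟩
  · exact e
  · have h1 := h.lt v hv
    have h2 := h.lt u hu
    rw [e'] at h1
    rw [← e] at h2
    exact absurd (h1.trans h2) (lt_irrefl _)

/-! ### The elimination loop -/

theorem Colouring.mem_colouredEdges_colourWhite {s : Colouring V} {v : V} {e f : Sym2 V}
    {F : Set (Sym2 V)} :
    f ∈ (s.colourWhite v e F).colouredEdges ↔ f ∈ s.colouredEdges ∨ f = e ∨ f ∈ F := by
  simp only [Colouring.colouredEdges, Colouring.colourWhite, Set.mem_union, Set.mem_insert_iff,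
    Set.mem_ofPred_eq]
  tauto

/-- What the elimination loop does, in terms of the set `W` of the new white vertices and the black
edges `s(v, f v)` chosen for them. -/
structure LoopResult (G : SimpleGraph V) (r : V → α) (l : List V) (s t : Colouring V)
    (W : Set V) (f : V → V) : Prop where
  subset : ∀ v ∈ W, v ∈ l
  whiteVerts : t.whiteVerts = s.whiteVerts ∪ W
  blackVerts : t.blackVerts = s.blackVerts ∪ {x | x ∈ l ∧ x ∉ W}
  blackEdges : t.blackEdges = s.blackEdges ∪ (fun v => s(v, f v)) '' W
  mem : ∀ v ∈ W, f v ∈ l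
  adj : ∀ v ∈ W, G.Adj v (f v)
  lt : ∀ v ∈ W, r v < r (f v)
  notMem : ∀ v ∈ W, s(v, f v) ∉ s.colouredEdges
  uncoloured : ∀ v ∈ W, ∀ p ∈ W, r p < r v → G.Adj p v → ¬ G.Adj p (f v)
  covered : ∀ a ∈ l, ∀ b ∈ l, G.Adj a b → s(a, b) ∈ s.colouredEdges ∨
    ∃ p ∈ W, (a = p ∨ G.Adj p a ∧ r p < r a) ∧ (b = p ∨ G.Adj p b ∧ r p < r b)

/-- The induction runs over arbitrary initial colourings. `notMem` passes to later choices the fact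
that edges inside an earlier white vertex's clique are no longer available, which yields
`uncoloured`. -/
theorem Loop.exists_loopResult {G : SimpleGraph V} {r : V → α} {l : List V} {s t : Colouring V}
    (h : Loop G l s t) (hl : l.Pairwise fun a b => r a < r b) :
    ∃ W f, LoopResult G r l s t W f := by
  classical
  induction h with
  | last v s =>
    refine ⟨∅, id, ⟨by simp, by simp [Colouring.colourBlack], ?_, by simp [Colouring.colourBlack],
      by simp, by simp, by simp, by simp, by simp, ?_⟩⟩
    · ext x; simp [Colouring.colourBlack, or_comm]
    · simp +contextual
  | white v w rest s t hw hvw hun _ ih =>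
    obtain ⟨hv, hrest⟩ := List.pairwise_cons.1 hl
    obtain ⟨W, f, R⟩ := ih hrest
    have hvrest : v ∉ rest := fun h => (hv v h).false
    have hvW : v ∉ W := fun h => hvrest (R.subset v h)
    have hne : ∀ x ∈ W, x ≠ v := fun x hx e => hvW (e ▸ hx)
    have hf : ∀ x ∈ W, Function.update f v w x = f x := fun x hx =>
      Function.update_of_ne (hne x hx) _ _
    have hvlt : ∀ x ∈ rest, r v < r x := hv
    refine ⟨insert v W, Function.update f v w, ⟨?_, ?_, ?_, ?_, ?_, ?_, ?_, ?_, ?_, ?_⟩⟩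
    · rintro x (rfl | hx)
      · exact List.mem_cons_self
      · exact List.mem_cons_of_mem _ (R.subset x hx)
    · rw [R.whiteVerts]
      ext x; simp [Colouring.colourWhite]; tauto
    · rw [R.blackVerts]
      ext x
      simp only [Colouring.colourWhite, Set.mem_union, Set.mem_ofPred_eq, List.mem_cons,
        Set.mem_insert_iff]
      have : x ∈ rest → x ≠ v := fun h e => hvrest (e ▸ h)
      tauto
    · have himage : (fun x => s(x, Function.update f v w x)) '' W = (fun x => s(x, f x)) '' W :=
        Set.image_congr fun x hx => by rw [hf x hx]
      rw [R.blackEdges, Set.image_insert_eq, Function.update_self, himage]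
      ext x; simp only [Colouring.colourWhite, Set.mem_union, Set.mem_insert_iff]; tauto
    · rintro x (rfl | hx)
      · simp [hw]
      · rw [hf x hx]; exact List.mem_cons_of_mem _ (R.mem x hx)
    · rintro x (rfl | hx)
      · simpa using hvw
      · rw [hf x hx]; exact R.adj x hx
    · rintro x (rfl | hx)
      · simpa using hvlt w hw
      · rw [hf x hx]; exact R.lt x hx
    · rintro x (rfl | hx)
      · simpa using hun
      · rw [hf x hx]
        exact fun hc => R.notMem x hx (Colouring.mem_colouredEdges_colourWhite.2 (.inl hc))
    · rintro x (rfl | hx) p (rfl | hp) hlt hpx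
      · exact absurd hlt (lt_irrefl _)
      · exact absurd (hlt.trans (hvlt p (R.subset p hp))) (lt_irrefl _)
      -- Here `p` is the vertex just eliminated. Were it adjacent to both ends of the black edge of
      -- `x`, that edge would lie in the clique of `p` and be coloured already.
      · rw [hf x hx]
        intro hpf
        refine R.notMem x hx (Colouring.mem_colouredEdges_colourWhite.2 (.inr (.inr ?_)))
        refine ⟨R.adj x hx, fun y hy => ?_⟩
        rcases Sym2.mem_iff.1 hy with rfl | rfl
        · exact .inr ⟨R.subset _ hx, hpx⟩
        · exact .inr ⟨R.mem _ hx, hpf⟩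
      · rw [hf x hx]; exact R.uncoloured x hx p hp hlt hpx
    · intro a ha b hb hab
      rcases List.mem_cons.1 ha with rfl | ha' <;> rcases List.mem_cons.1 hb with rfl | hb'
      · exact absurd hab (G.irrefl)
      · exact .inr ⟨a, .inl rfl, .inl rfl, .inr ⟨hab, hvlt b hb'⟩⟩
      · exact .inr ⟨b, .inl rfl, .inr ⟨hab.symm, hvlt a ha'⟩, .inl rfl⟩
      · rcases R.covered a ha' b hb' hab with hc | ⟨p, hp, h⟩
        · rcases Colouring.mem_colouredEdges_colourWhite.1 hc with hc | hc | hc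
          · exact .inl hc
          · have : v ∈ s(a, b) := hc ▸ Sym2.mem_mk_left v w
            rcases Sym2.mem_iff.1 this with rfl | rfl <;> contradiction
          · have H : ∀ x ∈ s(a, b), x = v ∨ G.Adj v x ∧ r v < r x := fun x hx =>
              (hc.2 x hx).imp_right fun h => ⟨h.2, hvlt x h.1⟩
            exact .inr ⟨v, .inl rfl, H a (Sym2.mem_mk_left a b), H b (Sym2.mem_mk_right a b)⟩
        · exact .inr ⟨p, .inr hp, h⟩
  | black v rest s t _ hcol _ ih =>
    obtain ⟨hv, hrest⟩ := List.pairwise_cons.1 hl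
    obtain ⟨W, f, R⟩ := ih hrest
    have hvrest : v ∉ rest := fun h => (hv v h).false
    refine ⟨W, f, ⟨fun x hx => List.mem_cons_of_mem _ (R.subset x hx), R.whiteVerts, ?_,
      R.blackEdges, fun x hx => List.mem_cons_of_mem _ (R.mem x hx), R.adj, R.lt, R.notMem,
      R.uncoloured, ?_⟩⟩
    · rw [R.blackVerts]
      ext x
      simp only [Colouring.colourBlack, Set.mem_union, Set.mem_ofPred_eq, List.mem_cons,
        Set.mem_insert_iff]
      have : x = v → x ∉ W := fun e h => hvrest (e ▸ R.subset x h)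
      tauto
    · intro a ha b hb hab
      rcases List.mem_cons.1 ha with rfl | ha' <;> rcases List.mem_cons.1 hb with rfl | hb'
      · exact absurd hab (G.irrefl)
      · exact .inl (hcol b hb' hab)
      · exact .inl (Sym2.eq_swap ▸ hcol a ha' hab.symm)
      · exact R.covered a ha' b hb' hab

theorem exists_loop (G : SimpleGraph V) (l : List V) (hl : l ≠ []) (s : Colouring V) :
    ∃ t, Loop G l s t := by
  induction l generalizing s with
  | nil => exact absurd rfl hl
  | cons v rest ih =>
    by_cases hrest : rest = []
    · subst hrest; exact ⟨_, .last v s⟩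
    · by_cases h : ∀ w ∈ rest, G.Adj v w → s(v, w) ∈ s.colouredEdges
      · obtain ⟨t, ht⟩ := ih hrest (s.colourBlack v)
        exact ⟨t, .black v rest s t hrest h ht⟩
      · push Not at h
        obtain ⟨w, hw, hvw, hun⟩ := h
        obtain ⟨t, ht⟩ := ih hrest
          (s.colourWhite v s(v, w) (closedNeighbourhoodEdges G v rest))
        exact ⟨t, .white v w rest s t hw hvw hun ht⟩

/-! ### Perfect elimination in terms of ranks -/

theorem IsPerfectElimination.adj_of_lt {G : SimpleGraph V} {r : V → α} {l : List V}
    (h : IsPerfectElimination G l) (hl : l.Pairwise fun a b => r a < r b) {v a b : V}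
    (hv : v ∈ l) (ha : a ∈ l) (hb : b ∈ l) (hva : G.Adj v a) (hvb : G.Adj v b)
    (hra : r v < r a) (hrb : r v < r b) (hab : a ≠ b) : G.Adj a b := by
  induction l with
  | nil => simp at hv
  | cons x rest ih =>
    obtain ⟨hx, hrest⟩ := List.pairwise_cons.1 hl
    have tail : ∀ y ∈ x :: rest, r v < r y → y ∈ rest := by
      intro y hy hvy
      rcases List.mem_cons.1 hy with rfl | hy
      · rcases List.mem_cons.1 hv with rfl | hv
        · exact absurd hvy (lt_irrefl _)
        · exact absurd (hvy.trans (hx v hv)) (lt_irrefl _)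
      · exact hy
    rcases List.mem_cons.1 hv with rfl | hv
    · exact h.1 ⟨tail a ha hra, hva⟩ ⟨tail b hb hrb, hvb⟩ hab
    · exact ih h.2 hrest hv (tail a ha hra) (tail b hb hrb)

theorem isPerfectElimination_of_pairwise {G : SimpleGraph V} {R : V → V → Prop} {l : List V}
    (hl : l.Pairwise R) (h : ∀ v ∈ l, ∀ a ∈ l, ∀ b ∈ l, R v a → R v b → G.Adj v a → G.Adj v b →
      a ≠ b → G.Adj a b) : IsPerfectElimination G l := by
  induction l with
  | nil => trivial
  | cons x rest ih =>
    obtain ⟨hx, hrest⟩ := List.pairwise_cons.1 hl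
    refine ⟨fun a ha b hb hab => ?_, ih hrest fun v hv a ha b hb => ?_⟩
    · exact h x List.mem_cons_self a (List.mem_cons_of_mem _ ha.1) b
        (List.mem_cons_of_mem _ hb.1) (hx a ha.1) (hx b hb.1) ha.2 hb.2 hab
    · exact h v (List.mem_cons_of_mem _ hv) a (List.mem_cons_of_mem _ ha) b
        (List.mem_cons_of_mem _ hb)

end Rank

theorem pairwise_idxOf_lt [DecidableEq V] {l : List V} (hl : l.Nodup) :
    l.Pairwise fun a b => l.idxOf a < l.idxOf b := by
  rw [List.pairwise_iff_getElem]
  intro i j hi hj hij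
  rwa [hl.idxOf_getElem, hl.idxOf_getElem]

/-! ### Chordal graphs -/

theorem isIndContained_cycleGraph {G : SimpleGraph V} {n : ℕ} (c : ℕ → V)
    (hne : ∀ i j, i < j → j < n → c i ≠ c j)
    (hadj : ∀ i j, i < j → j < n → (G.Adj (c i) (c j) ↔ j = i + 1 ∨ i = 0 ∧ j + 1 = n)) :
    (SimpleGraph.cycleGraph n).IsIndContained G := by
  have hcyc : ∀ i j : Fin n, i < j →
      ((SimpleGraph.cycleGraph n).Adj i j ↔ (j : ℕ) = i + 1 ∨ (i : ℕ) = 0 ∧ (j : ℕ) + 1 = n) := by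
    intro i j hij
    -- In `Fin n` the difference `i - j` wraps to `n + i - j`, which is `1` only for `i = 0`, `j = n
    -- - 1`.
    rw [SimpleGraph.cycleGraph_adj', Fin.coe_sub_iff_lt.2 hij, Fin.coe_sub_iff_le.2 hij.le]
    have := j.2
    have : (i : ℕ) < j := hij
    omega
  refine ⟨⟨⟨fun i => c i, fun i j hij => ?_⟩, fun {i j} => ?_⟩⟩
  · rcases lt_trichotomy i j with h | h | h
    · exact absurd hij (hne i j h j.2)
    · exact h
    · exact absurd hij.symm (hne j i h i.2)
  · change G.Adj (c i) (c j) ↔ _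
    rcases lt_trichotomy i j with h | h | h
    · rw [hcyc i j h, hadj i j h j.2]
    · subst h; simp
    · rw [SimpleGraph.adj_comm, SimpleGraph.adj_comm _ i j, hcyc j i h, hadj j i h i.2]

/-- A shortcut to an intermediate vertex would shorten the whole walk. -/
theorem dist_getVert_of_length_eq_dist {G : SimpleGraph V} {u v : V} {w : G.Walk u v}
    (hw : w.length = G.dist u v) {i : ℕ} (hi : i ≤ w.length) : G.dist u (w.getVert i) = i := by
  have h1 := SimpleGraph.dist_le (w.take i)
  have h2 := SimpleGraph.dist_le (w.drop i)
  have h3 := (w.take i).reachable.dist_triangle_left v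
  rw [SimpleGraph.Walk.take_length] at h1
  rw [SimpleGraph.Walk.drop_length] at h2
  omega

/-- The vertices outside the closed neighbourhood of `v`, together with `a` and `b`. -/
def avoiding (G : SimpleGraph V) (v a b : V) : Set V :=
  {x | x = a ∨ x = b ∨ x ≠ v ∧ ¬ G.Adj v x}

/-- In a chordal graph, nonadjacent neighbours `a`, `b` of `v` are not connected outside the closed
neighbourhood of `v`. -/
theorem IsChordal.not_joinedIn_avoiding {G : SimpleGraph V} (hG : IsChordal G) {v a b : V}
    (hva : G.Adj v a) (hvb : G.Adj v b) (hab : ¬ G.Adj a b) (hne : a ≠ b) :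
    ¬ JoinedIn G (avoiding G v a b) a b := by
  intro hj
  let T := avoiding G v a b
  have haT : a ∈ T := .inl rfl
  have hreach : ∀ x, JoinedIn G T a x → ∃ hx : x ∈ T, (G.induce T).Reachable ⟨a, haT⟩ ⟨x, hx⟩ := by
    intro x hx
    induction hx with
    | refl => exact ⟨haT, .rfl⟩
    | tail _ hyz ih =>
      obtain ⟨hy, h⟩ := ih
      exact ⟨hyz.2.2, h.trans (SimpleGraph.Adj.reachable (by simpa using hyz.1))⟩
  obtain ⟨hbT, hR⟩ := hreach b hj
  obtain ⟨w, hw⟩ := hR.exists_walk_length_eq_dist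
  -- Distance from `a` equals position on the walk, so the vertices are distinct and an edge can
  -- only join consecutive positions.
  have hdist := fun i (hi : i ≤ w.length) => dist_getVert_of_length_eq_dist hw hi
  have hlen : 2 ≤ w.length := by
    rw [hw]
    exact hR.one_lt_dist_of_ne_of_not_adj (fun h => hne (congrArg Subtype.val h))
      (by simpa using hab)
  have h0 : (w.getVert 0 : V) = a := by simp
  have hm : (w.getVert w.length : V) = b := by simp
  have hinj : ∀ i j, i < j → j ≤ w.length → (w.getVert i : V) ≠ w.getVert j := by
    intro i j hij hjm h
    have h1 := hdist i (by omega)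
    rw [Subtype.ext h, hdist j hjm] at h1
    omega
  have hchord : ∀ i j, i < j → j ≤ w.length →
      (G.Adj (w.getVert i) (w.getVert j) ↔ j = i + 1) := by
    intro i j hij hjm
    constructor
    · intro h
      have h' : (G.induce T).Adj (w.getVert i) (w.getVert j) := by simpa using h
      have h1 := (w.take i).reachable.dist_triangle_left (w.getVert j)
      rw [hdist i (by omega), hdist j hjm, SimpleGraph.dist_eq_one_iff_adj.2 h'] at h1
      omega
    · rintro rfl
      simpa using w.adj_getVert_succ (i := i) (by omega)
  have hvT : ∀ i, (w.getVert i : V) ≠ v := by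
    intro i h
    rcases (w.getVert i).2 with h' | h' | h'
    · exact hva.ne (h.symm.trans h')
    · exact hvb.ne (h.symm.trans h')
    · exact h'.1 h
  have hvadj : ∀ i ≤ w.length, (G.Adj (w.getVert i) v ↔ i = 0 ∨ i = w.length) := by
    intro i hi
    constructor
    · intro h
      by_contra hcon
      push Not at hcon
      rcases (w.getVert i).2 with h' | h' | h'
      · exact hinj 0 i (by omega) hi (h0.trans h'.symm)
      · exact hinj i w.length (by omega) le_rfl (h'.trans hm.symm)
      · exact h'.2 h.symm
    · rintro (rfl | rfl)
      · rw [h0]; exact hva.symm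
      · rw [hm]; exact hvb.symm
  -- The `w.length + 1` walk vertices are followed by `v` at index `w.length + 1`. Since `2 ≤
  -- w.length`, the cycle has at least four vertices.
  refine hG (w.length + 2) (by omega) (isIndContained_cycleGraph
    (fun i => if i ≤ w.length then w.getVert i else v) (fun i j hij hj => ?_)
    fun i j hij hj => ?_)
  · by_cases hjm : j ≤ w.length
    · simpa [hjm, show i ≤ w.length by omega] using hinj i j hij hjm
    · simpa [hjm, show i ≤ w.length by omega] using hvT i
  · by_cases hjm : j ≤ w.length
    · simp only [hjm, show i ≤ w.length by omega, if_true]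
      rw [hchord i j hij hjm]
      omega
    · simp only [hjm, show i ≤ w.length by omega, if_true, if_false]
      rw [hvadj i (by omega)]
      omega

/-! ### Lexicographic breadth-first search -/

theorem le_of_mem_lexLabel {G : SimpleGraph V} {n : ℕ} {l : List V} {v : V} {k : ℕ}
    (hk : k ∈ lexLabel G n l v) : k ≤ n := by
  induction l generalizing n with
  | nil => simp [lexLabel] at hk
  | cons x l ih =>
    rw [lexLabel] at hk
    split_ifs at hk
    · rcases List.mem_cons.1 hk with rfl | hk
      · exact le_rfl
      · exact (ih hk).trans (Nat.sub_le n 1)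
    · exact (ih hk).trans (Nat.sub_le n 1)

/-- If the label of `x` is not smaller than that of `y`, then the first visited vertex that
distinguishes `x` from `y` is a neighbour of `x`. -/
theorem exists_first_distinguishing {G : SimpleGraph V} {x y : V} {l : List V} {n : ℕ}
    (hn : l.length ≤ n) (hle : lexLabel G n l y ≤ lexLabel G n l x) {a : V} (ha : a ∈ l)
    (hay : G.Adj a y) (hax : ¬ G.Adj a x) :
    ∃ p d q, l = p ++ d :: q ∧ a ∈ q ∧ G.Adj d x ∧ ¬ G.Adj d y ∧
      ∀ z ∈ p, (G.Adj z x ↔ G.Adj z y) := by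
  induction l generalizing n with
  | nil => simp at ha
  | cons z l ih =>
    rw [List.length_cons] at hn
    have recurse (hz : G.Adj z x ↔ G.Adj z y)
        (h : lexLabel G (n - 1) l y ≤ lexLabel G (n - 1) l x) :
        ∃ p d q, z :: l = p ++ d :: q ∧ a ∈ q ∧ G.Adj d x ∧ ¬ G.Adj d y ∧
          ∀ z ∈ p, (G.Adj z x ↔ G.Adj z y) := by
      have hal : a ∈ l := by
        rcases List.mem_cons.1 ha with rfl | h
        · exact absurd (hz.2 hay) hax
        · exact h
      obtain ⟨p, d, q, rfl, haq, hd⟩ := ih (n := n - 1) (by omega) h hal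
      exact ⟨z :: p, d, q, rfl, haq, hd.1, hd.2.1, List.forall_mem_cons.2 ⟨hz, hd.2.2⟩⟩
    rw [lexLabel, lexLabel] at hle
    by_cases hzx : G.Adj z x <;> by_cases hzy : G.Adj z y
    · rw [if_pos hzx, if_pos hzy] at hle
      refine recurse (by tauto) (le_of_not_gt fun h => ?_)
      exact absurd hle (not_le_of_gt (List.cons_lt_cons_iff.2 (.inr ⟨rfl, h⟩)))
    · have hal : a ∈ l := by
        rcases List.mem_cons.1 ha with rfl | h
        · exact absurd hay hzy
        · exact h
      exact ⟨[], z, l, rfl, hal, hzx, hzy, by simp⟩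
    · rw [if_neg hzx, if_pos hzy] at hle
      refine absurd hle (not_le_of_gt ?_)
      cases h : lexLabel G (n - 1) l x with
      | nil => exact List.nil_lt_cons _ _
      | cons k t =>
        -- The label of `y` starts with `n`, while that of `x` has only entries up to `n - 1`. The
        -- length bound gives `n ≥ 1`, so the truncated subtraction really is smaller.
        have : k ≤ n - 1 := le_of_mem_lexLabel (G := G) (l := l) (v := x) (by rw [h]; simp)
        exact List.cons_lt_cons_iff.2 (.inl (by omega))
    · rw [if_neg hzx, if_neg hzy] at hle
      exact recurse (by tauto) hle

theorem mem_prefix_iff {r : V → ℕ} {l p q : List V} {b : V}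
    (hl : l.Pairwise fun a b => r a < r b) (h : l = p ++ b :: q) (z : V) :
    z ∈ p ↔ z ∈ l ∧ r z < r b := by
  subst h
  obtain ⟨-, hq, hpq⟩ := List.pairwise_append.1 hl
  constructor
  · exact fun hz => ⟨by simp [hz], hpq z hz b List.mem_cons_self⟩
  · rintro ⟨hz, hlt⟩
    rcases List.mem_append.1 hz with hz | hz
    · exact hz
    · rcases List.mem_cons.1 hz with rfl | hz
      · exact absurd hlt (lt_irrefl _)
      · exact absurd (hlt.trans ((List.pairwise_cons.1 hq).1 z hz)) (lt_irrefl _)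

/-- When `b` was chosen, its label was at least that of `c`. Since `a` counts for `c` only, an
earlier vertex must count for `b` only; `d` is the first vertex at which the two labels differ. -/
theorem IsLexBFSOrder.exists_distinguishing {G : SimpleGraph V} {r : V → ℕ} {l : List V}
    (h : IsLexBFSOrder G l) (hl : l.Pairwise fun a b => r a < r b) {a b c : V}
    (ha : a ∈ l) (hb : b ∈ l) (hc : c ∈ l) (hab : r a < r b) (hbc : r b < r c)
    (hac : G.Adj a c) (hnab : ¬ G.Adj a b) :
    ∃ d ∈ l, r d < r a ∧ G.Adj d b ∧ ¬ G.Adj d c ∧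
      ∀ z ∈ l, r z < r d → (G.Adj z b ↔ G.Adj z c) := by
  obtain ⟨vis, rest, rfl⟩ := List.append_of_mem hb
  have hvis := mem_prefix_iff hl rfl
  have hcrest : c ∈ rest := by
    rcases List.mem_append.1 hc with h' | h'
    · exact absurd (((hvis c).1 h').2.trans hbc) (lt_irrefl _)
    · rcases List.mem_cons.1 h' with rfl | h'
      · exact absurd hbc (lt_irrefl _)
      · exact h'
  obtain ⟨p, d, q, hpdq, haq, hdb, hdc, hz⟩ := exists_first_distinguishing (by simp)
    (h vis b rest rfl c hcrest) ((hvis a).2 ⟨ha, hab⟩) hac hnab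
  have hl' : vis.Pairwise fun a b => r a < r b := (List.pairwise_append.1 hl).1
  have hdvis : d ∈ vis := by simp [hpdq]
  refine ⟨d, ((hvis d).1 hdvis).1, ?_, hdb, hdc, fun z hzl hzd => hz z ?_⟩
  · subst hpdq
    exact (List.pairwise_cons.1 (List.pairwise_append.1 hl').2.1).1 a haq
  · exact (mem_prefix_iff hl' hpdq z).2
      ⟨(hvis z).2 ⟨hzl, hzd.trans ((hvis d).1 hdvis).2⟩, hzd⟩

theorem IsLexBFSOrder.adj_of_lt {G : SimpleGraph V} (hG : IsChordal G) {r : V → ℕ} {l : List V}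
    (h : IsLexBFSOrder G l) (hl : l.Pairwise fun a b => r a < r b) {v a b : V}
    (hv : v ∈ l) (ha : a ∈ l) (hb : b ∈ l) (hva : G.Adj v a) (hvb : G.Adj v b)
    (hab : r a < r b) (hbv : r b < r v) : G.Adj a b := by
  by_contra hnab
  have hne : a ≠ b := fun e => hab.ne (congrArg r e)
  have hnot := hG.not_joinedIn_avoiding hva hvb hnab hne
  -- Descent on triples `p`, `q`, `s` in visiting order, where `p` and `q` are connected to
  -- different ones of `a` and `b` outside the closed neighbourhood of `v`.
  have descent : ∀ (n : ℕ) (p q s A B : V), r p = n → p ∈ l → q ∈ l → s ∈ l →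
      r p < r q → r q < r s → r s ≤ r v → G.Adj p s → ¬ G.Adj p q →
      p ∈ avoiding G v a b → q ∈ avoiding G v a b →
      JoinedIn G (avoiding G v a b) A p → JoinedIn G (avoiding G v a b) q B →
      (∀ z ∈ l, r z < r p → ¬ G.Adj z s → ¬ G.Adj z v) →
      JoinedIn G (avoiding G v a b) A B := by
    intro n
    induction n using Nat.strong_induction_on with
    | _ n ih =>
      intro p q s A B hn hp hq hs hpq hqs hsv hps hnpq hpT hqT hAp hqB hinv
      obtain ⟨g, hg, hgp, hgq, hgs, hz⟩ := h.exists_distinguishing hl hp hq hs hpq hqs hps hnpq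
      have hgv : ¬ G.Adj g v := hinv g hg hgp hgs
      have hgT : g ∈ avoiding G v a b := by
        refine .inr (.inr ⟨fun e => ?_, fun e => hgv e.symm⟩)
        rw [e] at hgp
        omega
      have hgB : JoinedIn G (avoiding G v a b) g B := .head ⟨hgq, hgT, hqT⟩ hqB
      by_cases hgp' : G.Adj g p
      · exact hAp.trans (.head ⟨hgp'.symm, hpT, hgT⟩ hgB)
      -- The triple becomes `g`, `p`, `q` with the ends `A` and `B` exchanged. Before `g` the
      -- vertices `q` and `s` have the same neighbours, so nonneighbours of `q` are still
      -- nonneighbours of `v`.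
      · exact (ih (r g) (hn ▸ hgp) g p q B A rfl hg hp hq hgp hpq (by omega) hgq hgp' hgT hpT
          hgB.symm hAp.symm fun z hzl hzg hzq =>
            hinv z hzl (hzg.trans hgp) fun hzs => hzq ((hz z hzl hzg).2 hzs)).symm
  exact hnot (descent _ a b v a b rfl ha hb hv hab hbv le_rfl hva.symm hnab (.inl rfl)
    (.inr (.inl rfl)) .refl .refl fun _ _ _ h => h)

theorem IsLexBFSOrder.isPerfectElimination_reverse {G : SimpleGraph V} (hG : IsChordal G)
    {l : List V} (hl : l.Nodup) (h : IsLexBFSOrder G l) : IsPerfectElimination G l.reverse := by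
  classical
  have hp := pairwise_idxOf_lt hl
  refine isPerfectElimination_of_pairwise (R := fun a b => l.idxOf b < l.idxOf a)
    (List.pairwise_reverse.2 hp) fun v hv a ha b hb hra hrb hva hvb hab => ?_
  rw [List.mem_reverse] at hv ha hb
  rcases lt_trichotomy (l.idxOf a) (l.idxOf b) with hlt | heq | hlt
  · exact h.adj_of_lt hG hp hv ha hb hva hvb hlt hrb
  · exact absurd ((List.idxOf_inj ha).1 heq) hab
  · exact (h.adj_of_lt hG hp hv hb ha hvb hva hlt hra).symm

/-- Every finite set of vertices can be visited by a lexicographic breadth-first search. -/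
theorem exists_isLexBFSOrder [Finite V] (G : SimpleGraph V) (U : Set V) :
    ∃ l : List V, IsOrderingOf l U ∧ IsLexBFSOrder G l := by
  classical
  -- Partial searches of length `k` are extended greedily. Labels are numbered from `U.ncard`, the
  -- length of the finished list, so they do not change as the list grows.
  have key : ∀ k ≤ U.ncard, ∃ l : List V, l.length = k ∧ l.Nodup ∧ (∀ v ∈ l, v ∈ U) ∧
      ∀ p x q, l = p ++ x :: q → ∀ y ∈ U, y ∉ p →
        lexLabel G U.ncard p y ≤ lexLabel G U.ncard p x := by
    intro k
    induction k with
    | zero => exact fun _ => ⟨[], rfl, List.nodup_nil, by simp, by simp⟩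
    | succ k ih =>
      intro hk
      obtain ⟨l, hlen, hnd, hlU, hlex⟩ := ih (by omega)
      have hcard : {v | v ∈ l}.ncard = k := by
        rw [← hlen, ← List.toFinset_card_of_nodup hnd, ← Set.ncard_coe_finset]
        congr 1; ext; simp
      have hne : (U \ {v | v ∈ l}).Nonempty := by
        by_contra hcon
        rw [Set.not_nonempty_iff_eq_empty, Set.sdiff_eq_empty] at hcon
        have := Set.ncard_le_ncard hcon
        omega
      obtain ⟨x, ⟨hxU, hxl⟩, hx⟩ := Set.exists_max_image _ (lexLabel G U.ncard l)
        (Set.toFinite _) hne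
      refine ⟨l ++ [x], by simp [hlen], ?_, ?_, ?_⟩
      · exact List.nodup_append.2 ⟨hnd, List.nodup_singleton x, fun a ha b hb e => by
          rw [List.mem_singleton] at hb; exact hxl (hb ▸ e ▸ ha)⟩
      · intro v hv
        rcases List.mem_append.1 hv with hv | hv
        · exact hlU v hv
        · rw [List.mem_singleton] at hv; exact hv ▸ hxU
      · intro p z q hpq y hyU hyp
        rcases List.eq_nil_or_concat q with rfl | ⟨q', t, rfl⟩
        · obtain ⟨rfl, e⟩ := List.append_inj' hpq rfl
          obtain rfl := List.singleton_inj.1 e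
          exact hx y ⟨hyU, hyp⟩
        · have hpq' : l ++ [x] = (p ++ z :: q') ++ [t] := by simpa using hpq
          exact hlex p z q' (List.append_inj' hpq' rfl).1 y hyU hyp
  obtain ⟨l, hlen, hnd, hlU, hlex⟩ := key _ le_rfl
  refine ⟨l, ⟨hnd, fun v => ⟨hlU v, fun hv => ?_⟩⟩, fun p x q hpq y hy => ?_⟩
  · have hsub : (l.toFinset : Set V) ⊆ U := fun v hv => hlU v (by simpa using hv)
    have := Set.eq_of_subset_of_ncard_le hsub
      (by rw [Set.ncard_coe_finset, List.toFinset_card_of_nodup hnd, hlen])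
    rw [← this] at hv
    simpa using hv
  · rw [hlen]
    refine hlex p x q hpq y (hlU y (by simp [hpq, hy])) fun hyp => ?_
    rw [hpq] at hnd
    exact (List.nodup_append.1 hnd).2.2 y hyp y (List.mem_cons_of_mem x hy) rfl

/-! ### Runs of the algorithm -/

theorem exists_isRunWith (G : SimpleGraph V) {σ : G.ConnectedComponent → List V}
    (hσ : ∀ C, IsOrderingOf (σ C) C.supp) : ∃ s, IsRunWith G σ s := by
  have hne : ∀ C, σ C ≠ [] := by
    intro C h
    obtain ⟨v, hv⟩ := C.nonempty_supp
    have := ((hσ C).2 v).2 hv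
    simp [h] at this
  choose t ht using fun C => exists_loop G (σ C) (hne C) Colouring.empty
  exact ⟨⟨_, _, _, _⟩, t, ht, rfl, rfl, rfl, rfl⟩

/-- The component orderings are glued lexicographically, by an arbitrary numbering of the components
and then by position. Edges stay within components, so the numbering has no effect on the
conditions. -/
theorem IsRunWith.exists_isElimination [Finite V] {G : SimpleGraph V}
    {σ : G.ConnectedComponent → List V} {s : Colouring V}
    (hσ : ∀ C, IsOrderingOf (σ C) C.supp) (hpeo : ∀ C, IsPerfectElimination G (σ C))
    (hs : IsRunWith G σ s) :
    ∃ (r : V → Fin (Nat.card G.ConnectedComponent) ×ₗ ℕ) (W : Set V) (f : V → V),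
      IsElimination G r W f ∧ s.whiteVerts = W ∧ s.blackVerts = Wᶜ ∧
        s.blackEdges = (fun v => s(v, f v)) '' W := by
  classical
  obtain ⟨t, ht, hblack, hwhite, hedges, -⟩ := hs
  let e := Finite.equivFin G.ConnectedComponent
  let κ := G.connectedComponentMk
  let r : V → Fin (Nat.card G.ConnectedComponent) ×ₗ ℕ :=
    fun v => toLex (e (κ v), (σ (κ v)).idxOf v)
  have hmem : ∀ {C v}, v ∈ σ C ↔ κ v = C := fun {C v} => (hσ C).2 v
  have hmemκ : ∀ v, v ∈ σ (κ v) := fun v => hmem.2 rfl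
  have hadj : ∀ {u v}, G.Adj u v → κ u = κ v := fun h =>
    SimpleGraph.ConnectedComponent.connectedComponentMk_eq_of_adj h
  have hsorted : ∀ C, (σ C).Pairwise fun a b => r a < r b := by
    intro C
    refine (pairwise_idxOf_lt (hσ C).1).imp_of_mem fun {a b} ha hb hab => ?_
    obtain rfl := hmem.1 ha
    rw [Prod.Lex.toLex_lt_toLex]
    exact .inr ⟨by rw [hmem.1 hb], by simpa only [hmem.1 hb] using hab⟩
  choose W f R using fun C => (ht C).exists_loopResult (hsorted C)
  have hWκ : ∀ {C v}, v ∈ W C → κ v = C := fun {C v} h => hmem.1 ((R C).subset v h)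
  have hWiff : ∀ {v}, v ∈ ⋃ C, W C ↔ v ∈ W (κ v) := by
    intro v
    simp only [Set.mem_iUnion]
    exact ⟨fun ⟨C, h⟩ => by rwa [hWκ h], fun h => ⟨_, h⟩⟩
  refine ⟨r, ⋃ C, W C, fun v => f (κ v) v, ⟨?_, ?_, ?_, ?_, ?_, ?_⟩, ?_, ?_, ?_⟩
  · intro u v huv
    obtain ⟨h1, h2⟩ := Prod.ext_iff.1 (toLex.injective huv)
    have h1 : κ u = κ v := e.injective h1
    simp only [← h1] at h2
    exact (List.idxOf_inj (hmemκ u)).1 h2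
  · intro v a b hva hvb hra hrb hab
    exact (hpeo (κ v)).adj_of_lt (hsorted _) (hmemκ v) (hmem.2 (hadj hva).symm)
      (hmem.2 (hadj hvb).symm) hva hvb hra hrb hab
  · exact fun v hv => (R _).adj v (hWiff.1 hv)
  · exact fun v hv => (R _).lt v (hWiff.1 hv)
  · intro v hv p hp hlt hpv
    exact (R (κ v)).uncoloured v (hWiff.1 hv) p (hadj hpv ▸ hWiff.1 hp) hlt hpv
  · intro u v huv
    rcases (R (κ u)).covered u (hmemκ u) v (hmem.2 (hadj huv).symm) huv with h | ⟨p, hp, h⟩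
    · simp [Colouring.empty, Colouring.colouredEdges] at h
    · exact ⟨p, Set.mem_iUnion.2 ⟨_, hp⟩, h⟩
  · rw [hwhite]
    exact Set.iUnion_congr fun C => by simp [(R C).whiteVerts, Colouring.empty]
  · rw [hblack]
    ext v
    rw [Set.mem_compl_iff, hWiff]
    simp only [(R _).blackVerts, Colouring.empty, Set.empty_union, Set.mem_iUnion,
      Set.mem_ofPred_eq, hmem]
    exact ⟨fun ⟨C, hC, h⟩ => hC ▸ h, fun h => ⟨_, rfl, h⟩⟩
  · rw [hedges, Set.image_iUnion]
    refine Set.iUnion_congr fun C => ?_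
    rw [(R C).blackEdges, Colouring.empty, Set.empty_union]
    exact Set.image_congr fun v hv => by simp only [hWκ hv]

/-- Any run along perfect elimination orderings is optimal. -/
theorem IsPerfectEliminationRun.optimal [Fintype V] {G : SimpleGraph V} {s : Colouring V}
    (h : IsPerfectEliminationRun G s) :
    IsOptimalPositiveZeroForcingSet G s.blackVerts ∧
      positiveZeroForcingNumber G = s.blackVerts.ncard ∧
      s.whiteVerts = s.blackVertsᶜ ∧ s.blackEdges.ncard = s.whiteVerts.ncard ∧
      (positiveZeroForcingNumber G : ℤ) = (Fintype.card V : ℤ) - (cliqueCoverNumber G : ℤ) := by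
  obtain ⟨σ, hσ, hrun⟩ := h
  obtain ⟨r, W, f, hW, hwhite, hblack, hedges⟩ :=
    hrun.exists_isElimination (fun C => (hσ C).1) fun C => (hσ C).2
  obtain ⟨K, hK, hKW⟩ := hW.exists_cliqueCover
  have hforce : IsPositiveZeroForcingSet G s.blackVerts :=
    hblack ▸ hW.isPositiveZeroForcingSet
  have hcard : s.blackVerts.ncard + W.ncard = Fintype.card V := by
    rw [hblack, add_comm, Set.ncard_add_ncard_compl, Nat.card_eq_fintype_card]
  have hopt : ∀ B, IsPositiveZeroForcingSet G B → s.blackVerts.ncard ≤ B.ncard := by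
    intro B hB
    have := card_le_ncard_add_card_cliqueCover hB hK
    omega
  have hZ : positiveZeroForcingNumber G = s.blackVerts.ncard := by
    refine le_antisymm (Nat.sInf_le ⟨_, hforce, rfl⟩) ?_
    -- The set of sizes is nonempty, so the infimum is attained and is not the default value `0`.
    obtain ⟨B, hB, hBk⟩ := Nat.sInf_mem
      (s := {k | ∃ B : Set V, IsPositiveZeroForcingSet G B ∧ B.ncard = k}) ⟨_, _, hforce, rfl⟩
    exact (hopt B hB).trans hBk.le
  have hcc : cliqueCoverNumber G = W.ncard := by
    have hle : cliqueCoverNumber G ≤ K.card := Nat.sInf_le ⟨K, hK, rfl⟩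
    -- Conversely, applying the forcing bound to the black set shows that every cover has at least
    -- `|W|` cliques.
    refine le_antisymm (hle.trans hKW) ?_
    obtain ⟨K', hK', hk⟩ := Nat.sInf_mem
      (s := {k | ∃ K : Finset (Finset V), IsCliqueCover G K ∧ K.card = k}) ⟨_, K, hK, rfl⟩
    have := card_le_ncard_add_card_cliqueCover hforce hK'
    change W.ncard ≤ sInf _
    omega
  refine ⟨⟨hforce, hopt⟩, hZ, by rw [hwhite, hblack, compl_compl], ?_, ?_⟩
  · rw [hedges, hwhite, hW.injOn_edge.ncard_image]
  · rw [hZ, hcc]; omega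

theorem IsZplusChordalRun.isPerfectEliminationRun {G : SimpleGraph V} (hG : IsChordal G)
    {s : Colouring V} (h : IsZplusChordalRun G s) : IsPerfectEliminationRun G s := by
  obtain ⟨σ, hσ, hrun⟩ := h
  refine ⟨σ, fun C => ⟨(hσ C).1, ?_⟩, hrun⟩
  simpa using (hσ C).2.isPerfectElimination_reverse hG (List.nodup_reverse.2 (hσ C).1.1)

theorem exists_isZplusChordalRun [Finite V] (G : SimpleGraph V) : ∃ s, IsZplusChordalRun G s := by
  choose l hl hlex using fun C : G.ConnectedComponent => exists_isLexBFSOrder G C.supp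
  have hσ : ∀ C, IsOrderingOf (l C).reverse C.supp := fun C =>
    ⟨List.nodup_reverse.2 (hl C).1, fun v => by rw [List.mem_reverse, (hl C).2]⟩
  obtain ⟨s, hs⟩ := exists_isRunWith G hσ
  exact ⟨s, _, fun C => ⟨hσ C, by rw [List.reverse_reverse]; exact hlex C⟩, hs⟩

end ZplusChordal

theorem mainTheorem1 {V : Type*} [Fintype V] (G : SimpleGraph V)
    (hG : ZplusChordal.IsChordal G) :
    -- the algorithm can be carried out
    (∃ s : ZplusChordal.Colouring V, ZplusChordal.IsZplusChordalRun G s) ∧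
    -- the orderings that it uses are perfect elimination orderings
    (∀ (C : G.ConnectedComponent) (l : List V), ZplusChordal.IsOrderingOf l C.supp →
      ZplusChordal.IsLexBFSOrder G l → ZplusChordal.IsPerfectElimination G l.reverse) ∧
    -- its output is optimal, whatever choices are made, also with other perfect
    -- elimination orderings
    (∀ s : ZplusChordal.Colouring V,
      ZplusChordal.IsZplusChordalRun G s ∨ ZplusChordal.IsPerfectEliminationRun G s →
        ZplusChordal.IsOptimalPositiveZeroForcingSet G s.blackVerts ∧
        ZplusChordal.positiveZeroForcingNumber G = s.blackVerts.ncard ∧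
        s.whiteVerts = s.blackVertsᶜ ∧
        s.blackEdges.ncard = s.whiteVerts.ncard) ∧
    (ZplusChordal.positiveZeroForcingNumber G : ℤ) =
      (Fintype.card V : ℤ) - (ZplusChordal.cliqueCoverNumber G : ℤ) := by
  have hrun : ∀ s, ZplusChordal.IsZplusChordalRun G s ∨ ZplusChordal.IsPerfectEliminationRun G s →
      ZplusChordal.IsPerfectEliminationRun G s := fun s hs =>
    hs.elim (fun h => h.isPerfectEliminationRun hG) id
  obtain ⟨s, hs⟩ := ZplusChordal.exists_isZplusChordalRun G
  refine ⟨⟨s, hs⟩, fun C l hl hlex => hlex.isPerfectElimination_reverse hG hl.1,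
    fun s hs => ?_, (hrun s (.inl hs)).optimal.2.2.2.2⟩
  obtain ⟨h1, h2, h3, h4, -⟩ := (hrun s hs).optimal
  exact ⟨h1, h2, h3, h4⟩
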